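/- Let $\mathcal A$ be a countable set of atoms, and let formulas be generated by $A,B ::= a \mid \mathbb I \mid A\otimes B \mid A\multimap B \mid A\lhd B$ with $a\in\mathcal A$. **The system $\mathsf{IBV}$.** Its inference rules, written $\text{premise}\,/\,\text{conclusion}$, are the following, for all atoms $a$ and formulas $A,B,C,D$. *Positive rules:* $\mathbb I/(a\multimap a)$; $A/(\mathbb I\lhd A)$; $A/(A\lhd\mathbb I)$; $(A\otimes B)/(A\lhd B)$; $(A\otimes(B\multimap C))/((A\multimap B)\multimap C)$; $((A\multimap B)\otimes C)/(A\multimap(B\otimes C))$; $((A\multimap B)\lhd C)/(A\multimap(B\lhd C))$; $(B\lhd(A\multimap C))/(A\multimap(B\lhd C))$; $((A\multimap B)\lhd(C\multimap D))/((A\lhd C)\multimap(B\lhd D))$. *Negative rules:* $(A\lhd B)/(A\otimes B)$; $((A\multimap B)\multimap C)/(A\otimes(B\multimap C))$; $(A\multimap(B\otimes C))/((A\multimap B)\otimes C)$; $((A\otimes B)\lhd C)/(A\otimes(B\lhd C))$; $(B\lhd(A\otimes C))/(A\otimes(B\lhd C))$; $((A\otimes B)\lhd(C\otimes D))/((A\lhd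 C)\otimes(B\lhd D))$. *Rules that are both positive and negative:* $(A\otimes B)/(B\otimes A)$; $((A\otimes B)\otimes C)/(A\otimes(B\otimes C))$; $((A\lhd B)\lhd C)/(A\lhd(B\lhd C))$; $(A\lhd(B\lhd C))/((A\lhd B)\lhd C)$; $A/(\mathbb I\otimes A)$; $A/(\mathbb I\multimap A)$; $((A\otimes B)\multimap C)/(A\multimap(B\multimap C))$; $(A\multimap(B\multimap C))/((A\otimes B)\multimap C)$. Positive and negative derivations, each with a premise and a conclusion, are defined inductively. Every formula $A$ is a positive and a negative derivation from $A$ to $A$. If $\mathcal D$ and $\mathcal E$ are derivations of the same polarity, from $A$ to $B$ and from $C$ to $D$, then $\mathcal D\otimes\mathcal E$ and $\mathcal D\lhd\mathcal E$ are derivations of that polarity, from $A\otimes C$ to $B\otimes D$ and from $A\lhd C$ to $B\lhd D$. If $\mathcal D$ from $A$ to $B$ and $\mathcal E$ from $C$ to $D$ have opposite polarities, then $\mathcal D\multimap\mathcal E$ is a derivation from $A\multimap C$ to $B\multimap D$ with the polarity of $\mathcal E$. A derivation from $A$ to $B$, an instance $B/C$ of a rule and a derivation from $C$ to $D$, all three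 of the same polarity, compose to a derivation from $A$ to $D$ of that polarity. A formula $A$ is provable in $\mathsf{IBV}$, written $\vdash_{\mathsf{IBV}}A$, if there is a positive derivation from $\mathbb I$ to $A$. **The system $\mathsf{INML}$.** A sequent $\Gamma\vdash A$ consists of a finite multiset $\Gamma$ of formulas and a formula $A$. The rules are: $$\frac{}{a\vdash a}\qquad \frac{\Gamma,A\vdash B}{\Gamma\vdash A\multimap B}\qquad \frac{\Gamma\vdash A\quad B,\Delta\vdash C}{\Gamma,A\multimap B,\Delta\vdash C}\qquad \frac{}{\vdash\mathbb I}\qquad \frac{\Gamma\vdash A}{\Gamma,\mathbb I\vdash A}$$ $$\frac{\Gamma,A,B\vdash C}{\Gamma,A\otimes B\vdash C}\qquad \frac{\Gamma\vdash A\quad\Delta\vdash B}{\Gamma,\Delta\vdash A\otimes B}\qquad \frac{\Gamma,A_1,\dots,A_n\vdash A\quad \Delta,B_1,\dots,B_n\vdash B}{\Gamma,\Delta,A_1\lhd B_1,\dots,A_n\lhd B_n\vdash A\lhd B}\ (n\ge 0).$$ The associative-cut rules are $$\frac{\Gamma\vdash(A\lhd B)\lhd C\quad A\lhd(B\lhd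 C),\Delta\vdash D}{\Gamma,\Delta\vdash D}\ \mathsf{acut_L}\qquad \frac{\Gamma\vdash A\lhd(B\lhd C)\quad (A\lhd B)\lhd C,\Delta\vdash D}{\Gamma,\Delta\vdash D}\ \mathsf{acut_R}.$$ A formula $A$ is provable in a sequent calculus if the sequent $\vdash A$ has a derivation in it. **Theorem.** For every formula $A$: $\ \vdash_{\mathsf{IBV}}A$ if and only if $\ \vdash_{\mathsf{INML}\cup\{\mathsf{acut_L},\mathsf{acut_R}\}}A$. -/

import Mathlib

namespace IBV

/-- Formulas over a set `α` of atoms: `A, B ::= a | 𝕀 | A ⊗ B | A ⊸ B | A ◁ B`. -/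
inductive Formula (α : Type*) where
  | atom (a : α) : Formula α
  | unit : Formula α
  | tens (A B : Formula α) : Formula α
  | imp (A B : Formula α) : Formula α
  | seq (A B : Formula α) : Formula α

infix:65 " ⊗ᶠ " => Formula.tens
infix:65 " ⊸ᶠ " => Formula.imp
infix:65 " ◁ᶠ " => Formula.seq

/-- The polarity of a position in a formula. -/
inductive Polarity where
  | pos : Polarity
  | neg : Polarity

/-- The opposite polarity. -/
def Polarity.flip : Polarity → Polarity
  | .pos => .neg
  | .neg => .pos

/-- A set of deep inference rules: `R p A B` says that there is an instance with premise `A` and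
conclusion `B` that may be used at positions of polarity `p`. -/
abbrev DeepRules (α : Type*) := Polarity → Formula α → Formula α → Prop

/-- The inference rules of system `IBV`, as `premise`, `conclusion`. White-circle rules are for
positive positions, black-circle rules for negative positions, and the undecorated rules
(quantified over `p`) for both. -/
inductive Rules {α : Type*} : DeepRules α
  | ai_down (a : α) : Rules .pos .unit (.atom a ⊸ᶠ .atom a)
  | u_seq (A : Formula α) : Rules .pos A (.unit ◁ᶠ A)
  | u_coseq (A : Formula α) : Rules .pos A (A ◁ᶠ .unit)
  | ref_pos (A B : Formula α) : Rules .pos (A ⊗ᶠ B) (A ◁ᶠ B)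
  | ref_neg (A B : Formula α) : Rules .neg (A ◁ᶠ B) (A ⊗ᶠ B)
  | sL_pos (A B C : Formula α) : Rules .pos (A ⊗ᶠ (B ⊸ᶠ C)) ((A ⊸ᶠ B) ⊸ᶠ C)
  | sR_pos (A B C : Formula α) : Rules .pos ((A ⊸ᶠ B) ⊗ᶠ C) (A ⊸ᶠ (B ⊗ᶠ C))
  | sL_neg (A B C : Formula α) : Rules .neg ((A ⊸ᶠ B) ⊸ᶠ C) (A ⊗ᶠ (B ⊸ᶠ C))
  | sR_neg (A B C : Formula α) : Rules .neg (A ⊸ᶠ (B ⊗ᶠ C)) ((A ⊸ᶠ B) ⊗ᶠ C)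
  | sqL_pos (A B C : Formula α) : Rules .pos ((A ⊸ᶠ B) ◁ᶠ C) (A ⊸ᶠ (B ◁ᶠ C))
  | sqR_pos (A B C : Formula α) : Rules .pos (B ◁ᶠ (A ⊸ᶠ C)) (A ⊸ᶠ (B ◁ᶠ C))
  | sqL_neg (A B C : Formula α) : Rules .neg ((A ⊗ᶠ B) ◁ᶠ C) (A ⊗ᶠ (B ◁ᶠ C))
  | sqR_neg (A B C : Formula α) : Rules .neg (B ◁ᶠ (A ⊗ᶠ C)) (A ⊗ᶠ (B ◁ᶠ C))
  | q_pos (A B C D : Formula α) :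
      Rules .pos ((A ⊸ᶠ B) ◁ᶠ (C ⊸ᶠ D)) ((A ◁ᶠ C) ⊸ᶠ (B ◁ᶠ D))
  | q_neg (A B C D : Formula α) :
      Rules .neg ((A ⊗ᶠ B) ◁ᶠ (C ⊗ᶠ D)) ((A ◁ᶠ C) ⊗ᶠ (B ◁ᶠ D))
  | com (p : Polarity) (A B : Formula α) : Rules p (A ⊗ᶠ B) (B ⊗ᶠ A)
  | asso_tens (p : Polarity) (A B C : Formula α) :
      Rules p ((A ⊗ᶠ B) ⊗ᶠ C) (A ⊗ᶠ (B ⊗ᶠ C))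
  | asso_seqL (p : Polarity) (A B C : Formula α) :
      Rules p ((A ◁ᶠ B) ◁ᶠ C) (A ◁ᶠ (B ◁ᶠ C))
  | asso_seqR (p : Polarity) (A B C : Formula α) :
      Rules p (A ◁ᶠ (B ◁ᶠ C)) ((A ◁ᶠ B) ◁ᶠ C)
  | u_tens (p : Polarity) (A : Formula α) : Rules p A (.unit ⊗ᶠ A)
  | u_imp (p : Polarity) (A : Formula α) : Rules p A (.unit ⊸ᶠ A)
  | cur (p : Polarity) (A B C : Formula α) : Rules p ((A ⊗ᶠ B) ⊸ᶠ C) (A ⊸ᶠ (B ⊸ᶠ C))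
  | ruc (p : Polarity) (A B C : Formula α) : Rules p (A ⊸ᶠ (B ⊸ᶠ C)) ((A ⊗ᶠ B) ⊸ᶠ C)

/-- `Derivation R p A B`: there is an (open deduction) derivation of polarity `p` with premise `A`
and conclusion `B` whose rules are all from `R`. -/
inductive Derivation {α : Type*} (R : DeepRules α) : Polarity → Formula α → Formula α → Prop
  | refl (p : Polarity) (A : Formula α) : Derivation R p A A
  | tens {p : Polarity} {A B C D : Formula α} :
      Derivation R p A B → Derivation R p C D → Derivation R p (A ⊗ᶠ C) (B ⊗ᶠ D)
  | seq {p : Polarity} {A B C D : Formula α} :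
      Derivation R p A B → Derivation R p C D → Derivation R p (A ◁ᶠ C) (B ◁ᶠ D)
  | imp {p : Polarity} {A B C D : Formula α} :
      Derivation R p.flip A B → Derivation R p C D → Derivation R p (A ⊸ᶠ C) (B ⊸ᶠ D)
  | comp {p : Polarity} {A B C D : Formula α} :
      Derivation R p A B → R p B C → Derivation R p C D → Derivation R p A D

/-- A proof of `A` is a positive derivation with premise the unit and conclusion `A`. -/
def DeepProvable {α : Type*} (R : DeepRules α) (A : Formula α) : Prop :=
  Derivation R .pos .unit A

/-- A sequent `Γ ⊢ A`; the antecedent is a finite collection of formula occurrences. -/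
structure Sequent (α : Type*) where
  ante : Multiset (Formula α)
  succ : Formula α

/-- A set of sequent rules: `R Ps S` says that there is an instance with list of premises `Ps` and
conclusion `S`. -/
abbrev SequentRules (α : Type*) := List (Sequent α) → Sequent α → Prop

/-- The (cut-free) inference rules of the sequent calculus `INML`. In the rule `seq`, the pairs
`(A₁, B₁), …, (Aₙ, Bₙ)`, with `n ≥ 0`, are the elements of `P`. -/
inductive INML {α : Type*} : SequentRules α
  | ax (a : α) : INML [] ⟨{.atom a}, .atom a⟩
  | impR (Γ : Multiset (Formula α)) (A B : Formula α) :
      INML [⟨Γ + {A}, B⟩] ⟨Γ, A ⊸ᶠ B⟩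
  | impL (Γ Δ : Multiset (Formula α)) (A B C : Formula α) :
      INML [⟨Γ, A⟩, ⟨{B} + Δ, C⟩] ⟨Γ + {A ⊸ᶠ B} + Δ, C⟩
  | unitR : INML [] ⟨0, .unit⟩
  | unitL (Γ : Multiset (Formula α)) (A : Formula α) :
      INML [⟨Γ, A⟩] ⟨Γ + {.unit}, A⟩
  | tensL (Γ : Multiset (Formula α)) (A B C : Formula α) :
      INML [⟨Γ + {A} + {B}, C⟩] ⟨Γ + {A ⊗ᶠ B}, C⟩
  | tensR (Γ Δ : Multiset (Formula α)) (A B : Formula α) :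
      INML [⟨Γ, A⟩, ⟨Δ, B⟩] ⟨Γ + Δ, A ⊗ᶠ B⟩
  | seq (Γ Δ : Multiset (Formula α)) (P : Multiset (Formula α × Formula α)) (A B : Formula α) :
      INML [⟨Γ + P.map Prod.fst, A⟩, ⟨Δ + P.map Prod.snd, B⟩]
        ⟨Γ + Δ + P.map (fun x => x.1 ◁ᶠ x.2), A ◁ᶠ B⟩

/-- The left associative-cut rule. -/
inductive AcutL {α : Type*} : SequentRules α
  | mk (Γ Δ : Multiset (Formula α)) (A B C D : Formula α) :
      AcutL [⟨Γ, (A ◁ᶠ B) ◁ᶠ C⟩, ⟨{A ◁ᶠ (B ◁ᶠ C)} + Δ, D⟩] ⟨Γ + Δ, D⟩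

/-- The right associative-cut rule. -/
inductive AcutR {α : Type*} : SequentRules α
  | mk (Γ Δ : Multiset (Formula α)) (A B C D : Formula α) :
      AcutR [⟨Γ, A ◁ᶠ (B ◁ᶠ C)⟩, ⟨{(A ◁ᶠ B) ◁ᶠ C} + Δ, D⟩] ⟨Γ + Δ, D⟩

/-- A sequent is derivable from a set `R` of sequent rules if it is the root of a finite derivation
tree, without open premises, all of whose steps are instances of rules in `R`. -/
inductive SequentDerivable {α : Type*} (R : SequentRules α) : Sequent α → Prop
  | step {Ps : List (Sequent α)} {S : Sequent α} :
      R Ps S → (∀ P ∈ Ps, SequentDerivable R P) → SequentDerivable R S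

/-- A formula `A` is provable in a sequent calculus if the sequent `⊢ A` is derivable. -/
def SequentProvable {α : Type*} (R : SequentRules α) (A : Formula α) : Prop :=
  SequentDerivable R ⟨0, A⟩

end IBV

/-! From `IBV` to sequents: a positive derivation from `A` to `B` is read as the sequent `A ⊢ B`, a
negative one as `B ⊢ A`. Each rule becomes a derivable sequent, with associativity of `◁` supplied
by the associative cuts, and composition becomes cut. This direction therefore rests on cut
elimination (`cutAdmissible`). The associative cuts do not obstruct it: they introduce no formula
into their conclusion, so an ordinary cut permutes above them.

From sequents to `IBV`: associative cuts are not simulated step by step but interpreted in a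
Chu-style model built from `IBV` provability. A point consists of a set of contexts `w` and a set of
formulas `S` such that every `w ⊸ S` is provable. Points form a residuated ordered commutative
monoid with a second product `◁`, which is associative on the nose and satisfies an interchange
inequality. Hence the calculus is sound (`Entails.prod_interp_le`), an associative cut being mere
transitivity. As in Okada's semantic cut elimination, each formula lies in both halves of its own
interpretation (`Formula.mem_interp`). If `⊢ A`, then `1 ≤ A.interp`, so the empty context lies in
the positive half; pairing it with `A` gives a proof of `A`.

The empty context is kept apart from the formula `𝕀` because `◁` has no unit rules at negative
positions. -/

namespace IBV

variable {α : Type*}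

/-! ### The sequent calculus with associative cuts -/

/-- Derivability in `INML` with both associative-cut rules. -/
inductive Entails : Multiset (Formula α) → Formula α → Prop
  | ax (a : α) : Entails {.atom a} (.atom a)
  | impR {Γ : Multiset (Formula α)} {A B : Formula α} :
      Entails (A ::ₘ Γ) B → Entails Γ (A ⊸ᶠ B)
  | impL {Γ Δ : Multiset (Formula α)} {A B C : Formula α} :
      Entails Γ A → Entails (B ::ₘ Δ) C → Entails ((A ⊸ᶠ B) ::ₘ (Γ + Δ)) C
  | unitR : Entails 0 .unit
  | unitL {Γ : Multiset (Formula α)} {A : Formula α} :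
      Entails Γ A → Entails (.unit ::ₘ Γ) A
  | tensL {Γ : Multiset (Formula α)} {A B C : Formula α} :
      Entails (A ::ₘ B ::ₘ Γ) C → Entails ((A ⊗ᶠ B) ::ₘ Γ) C
  | tensR {Γ Δ : Multiset (Formula α)} {A B : Formula α} :
      Entails Γ A → Entails Δ B → Entails (Γ + Δ) (A ⊗ᶠ B)
  | seq {Γ Δ : Multiset (Formula α)} (P : Multiset (Formula α × Formula α)) {A B : Formula α} :
      Entails (Γ + P.map Prod.fst) A → Entails (Δ + P.map Prod.snd) B →
        Entails (Γ + Δ + P.map (fun x => x.1 ◁ᶠ x.2)) (A ◁ᶠ B)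
  | acutL {Γ Δ : Multiset (Formula α)} {A B C D : Formula α} :
      Entails Γ ((A ◁ᶠ B) ◁ᶠ C) → Entails ((A ◁ᶠ (B ◁ᶠ C)) ::ₘ Δ) D → Entails (Γ + Δ) D
  | acutR {Γ Δ : Multiset (Formula α)} {A B C D : Formula α} :
      Entails Γ (A ◁ᶠ (B ◁ᶠ C)) → Entails (((A ◁ᶠ B) ◁ᶠ C) ::ₘ Δ) D → Entails (Γ + Δ) D

theorem Entails.of_eq {Γ Δ : Multiset (Formula α)} {A : Formula α} (h : Entails Γ A)
    (e : Γ = Δ) : Entails Δ A := e ▸ h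

theorem Entails.of_sequentDerivable {S : Sequent α}
    (h : SequentDerivable (INML ⊔ AcutL ⊔ AcutR) S) : Entails S.ante S.succ := by
  induction h with
  | step hR _ ih =>
    rcases hR with (hR | hR) | hR
    · cases hR with
      | ax a => exact .ax a
      | impR Γ A B =>
        have h := ih _ (List.mem_cons_self ..)
        exact .impR (h.of_eq (by simp only [← Multiset.singleton_add]; abel))
      | impL Γ Δ A B C =>
        have h₁ := ih _ (List.mem_cons_self ..)
        have h₂ := ih _ (List.mem_cons_of_mem _ (List.mem_cons_self ..))
        exact (Entails.impL h₁ h₂).of_eq (by simp only [← Multiset.singleton_add]; abel)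
      | unitR => exact .unitR
      | unitL Γ A =>
        have h := ih _ (List.mem_cons_self ..)
        exact (Entails.unitL h).of_eq (by simp only [← Multiset.singleton_add]; abel)
      | tensL Γ A B C =>
        have h := ih _ (List.mem_cons_self ..)
        exact (Entails.tensL (A := A) (B := B) (Γ := Γ)
          (h.of_eq (by simp only [← Multiset.singleton_add]; abel))).of_eq
          (by simp only [← Multiset.singleton_add]; abel)
      | tensR Γ Δ A B =>
        exact .tensR (ih _ (List.mem_cons_self ..))
          (ih _ (List.mem_cons_of_mem _ (List.mem_cons_self ..)))
      | seq Γ Δ P A B =>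
        exact .seq P (ih _ (List.mem_cons_self ..))
          (ih _ (List.mem_cons_of_mem _ (List.mem_cons_self ..)))
    · cases hR with
      | mk Γ Δ A B C D =>
        exact .acutL (ih _ (List.mem_cons_self ..))
          (ih _ (List.mem_cons_of_mem _ (List.mem_cons_self ..)))
    · cases hR with
      | mk Γ Δ A B C D =>
        exact .acutR (ih _ (List.mem_cons_self ..))
          (ih _ (List.mem_cons_of_mem _ (List.mem_cons_self ..)))

theorem Entails.sequentDerivable {Γ : Multiset (Formula α)} {A : Formula α} (h : Entails Γ A) :
    SequentDerivable (INML ⊔ AcutL ⊔ AcutR) ⟨Γ, A⟩ := by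
  induction h with
  | ax a => exact .step (Or.inl (Or.inl (.ax a))) (by simp)
  | @impR Γ A B _ ih =>
    refine .step (Or.inl (Or.inl (.impR Γ A B))) ?_
    rw [add_comm, Multiset.singleton_add]
    simpa using ih
  | @impL Γ Δ A B C _ _ ih₁ ih₂ =>
    have h := SequentDerivable.step (R := INML ⊔ AcutL ⊔ AcutR)
      (Or.inl (Or.inl (.impL Γ Δ A B C))) (by simpa using ⟨ih₁, ih₂⟩)
    convert h using 2
    simp only [← Multiset.singleton_add]; abel
  | unitR => exact .step (Or.inl (Or.inl .unitR)) (by simp)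
  | @unitL Γ A _ ih =>
    have h := SequentDerivable.step (R := INML ⊔ AcutL ⊔ AcutR)
      (Or.inl (Or.inl (.unitL Γ A))) (by simpa using ih)
    convert h using 2
    simp only [← Multiset.singleton_add]; abel
  | @tensL Γ A B C _ ih =>
    have e : A ::ₘ B ::ₘ Γ = Γ + {A} + {B} := by simp only [← Multiset.singleton_add]; abel
    rw [e] at ih
    have h := SequentDerivable.step (R := INML ⊔ AcutL ⊔ AcutR)
      (Or.inl (Or.inl (.tensL Γ A B C))) (by rintro P (_ | ⟨_, ⟨⟩⟩); exact ih)
    convert h using 2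
    simp only [← Multiset.singleton_add]; abel
  | @tensR Γ Δ A B _ _ ih₁ ih₂ =>
    exact .step (Or.inl (Or.inl (.tensR Γ Δ A B))) (by simpa using ⟨ih₁, ih₂⟩)
  | @seq Γ Δ P A B _ _ ih₁ ih₂ =>
    exact .step (Or.inl (Or.inl (.seq Γ Δ P A B))) (by simpa using ⟨ih₁, ih₂⟩)
  | @acutL Γ Δ A B C D _ _ ih₁ ih₂ =>
    exact .step (Or.inl (Or.inr (.mk Γ Δ A B C D))) (by simpa using ⟨ih₁, ih₂⟩)
  | @acutR Γ Δ A B C D _ _ ih₁ ih₂ =>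
    exact .step (Or.inr (.mk Γ Δ A B C D)) (by simpa using ⟨ih₁, ih₂⟩)

/-! ### Cut elimination -/

/-- A formula `X` in the antecedent can be replaced by `Γ` as soon as this is possible in the
conclusions of the left rules in which `X` is principal. -/
theorem Entails.replace {X : Formula α} {Γ : Multiset (Formula α)}
    (hax : ∀ a, X = .atom a → Entails Γ (.atom a))
    (himp : ∀ A B Γ' Δ C, X = A ⊸ᶠ B → Entails Γ' A → Entails (B ::ₘ Δ) C →
      Entails (Γ + (Γ' + Δ)) C)
    (hunit : ∀ Δ C, X = .unit → Entails Δ C → Entails (Γ + Δ) C)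
    (htens : ∀ A B Δ C, X = A ⊗ᶠ B → Entails (A ::ₘ B ::ₘ Δ) C → Entails (Γ + Δ) C)
    (hseq : ∀ A B Γ' Δ (P : Multiset (Formula α × Formula α)) C D, X = A ◁ᶠ B →
      Entails (A ::ₘ (Γ' + P.map Prod.fst)) C → Entails (B ::ₘ (Δ + P.map Prod.snd)) D →
      Entails (Γ + (Γ' + Δ + P.map (fun x => x.1 ◁ᶠ x.2))) (C ◁ᶠ D))
    {Θ : Multiset (Formula α)} {C : Formula α} (h : Entails Θ C) :
    ∀ Δ, Θ = X ::ₘ Δ → Entails (Γ + Δ) C := by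
  classical
  induction h with
  | ax a =>
    intro Δ e
    obtain ⟨rfl, rfl⟩ := Multiset.singleton_eq_cons_iff Δ |>.mp e
    simpa using hax a rfl
  | impR _ ih =>
    intro Δ e
    subst e
    exact .impR ((ih _ (Multiset.cons_swap _ _ _)).of_eq (by simp))
  | @impL Γ' Δ' A B C h₁ h₂ ih₁ ih₂ =>
    intro Δ e
    rcases Multiset.cons_eq_cons.mp e with ⟨hX, rfl⟩ | ⟨-, Θ, e', rfl⟩
    · exact himp A B _ _ _ hX.symm h₁ h₂
    · have hm : X ∈ Γ' + Δ' := e' ▸ Multiset.mem_cons_self _ _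
      rcases Multiset.mem_add.mp hm with hm | hm
      · obtain ⟨Γ₁, rfl⟩ := Multiset.exists_cons_of_mem hm
        obtain rfl : Γ₁ + Δ' = Θ := by simpa using e'
        refine (Entails.impL (ih₁ _ rfl) h₂).of_eq ?_
        simp only [← Multiset.singleton_add]; abel
      · obtain ⟨Δ₁, rfl⟩ := Multiset.exists_cons_of_mem hm
        obtain rfl : Γ' + Δ₁ = Θ := by simpa using e'
        refine (Entails.impL (B := B) (Δ := Γ + Δ₁) h₁
          ((ih₂ _ (Multiset.cons_swap _ _ _)).of_eq (by simp))).of_eq ?_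
        simp only [← Multiset.singleton_add]; abel
  | unitR => intro Δ e; exact absurd e (Multiset.zero_ne_cons)
  | unitL h ih =>
    intro Δ e
    rcases Multiset.cons_eq_cons.mp e with ⟨hX, rfl⟩ | ⟨-, Θ, e', rfl⟩
    · exact hunit _ _ hX.symm h
    · refine (Entails.unitL (ih _ e')).of_eq ?_
      simp only [← Multiset.singleton_add]; abel
  | @tensL Γ' A B C h ih =>
    intro Δ e
    rcases Multiset.cons_eq_cons.mp e with ⟨hX, rfl⟩ | ⟨-, Θ, e', rfl⟩
    · exact htens _ _ _ _ hX.symm h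
    · refine (Entails.tensL (A := A) (B := B) (Γ := Γ + Θ)
        ((ih (A ::ₘ B ::ₘ Θ) ?_).of_eq ?_)).of_eq ?_
      · rw [e']; simp only [← Multiset.singleton_add]; abel
      · simp only [← Multiset.singleton_add]; abel
      · simp only [← Multiset.singleton_add]; abel
  | @tensR Γ' Δ' A B h₁ h₂ ih₁ ih₂ =>
    intro Δ e
    have hm : X ∈ Γ' + Δ' := e ▸ Multiset.mem_cons_self _ _
    rcases Multiset.mem_add.mp hm with hm | hm
    · obtain ⟨Γ₁, rfl⟩ := Multiset.exists_cons_of_mem hm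
      obtain rfl : Γ₁ + Δ' = Δ := by simpa using e
      exact (Entails.tensR (ih₁ _ rfl) h₂).of_eq (by abel)
    · obtain ⟨Δ₁, rfl⟩ := Multiset.exists_cons_of_mem hm
      obtain rfl : Γ' + Δ₁ = Δ := by simpa using e
      exact (Entails.tensR h₁ (ih₂ _ rfl)).of_eq (by abel)
  | @seq Γ' Δ' P A B h₁ h₂ ih₁ ih₂ =>
    intro Δ e
    have hm : X ∈ Γ' + Δ' + P.map (fun x => x.1 ◁ᶠ x.2) := e ▸ Multiset.mem_cons_self _ _
    rcases Multiset.mem_add.mp hm with hm | hm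
    · rcases Multiset.mem_add.mp hm with hm | hm
      · obtain ⟨Γ₁, rfl⟩ := Multiset.exists_cons_of_mem hm
        obtain rfl : Γ₁ + Δ' + P.map (fun x => x.1 ◁ᶠ x.2) = Δ := by simpa using e
        refine (Entails.seq (Γ := Γ + Γ₁) P
          ((ih₁ (Γ₁ + P.map Prod.fst) (by simp)).of_eq (by abel)) h₂).of_eq (by abel)
      · obtain ⟨Δ₁, rfl⟩ := Multiset.exists_cons_of_mem hm
        obtain rfl : Γ' + Δ₁ + P.map (fun x => x.1 ◁ᶠ x.2) = Δ := by simpa using e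
        refine (Entails.seq (Δ := Γ + Δ₁) P h₁
          ((ih₂ (Δ₁ + P.map Prod.snd) (by simp)).of_eq (by abel))).of_eq (by abel)
    -- Here the replaced formula is itself one of the sequential pairs, the principal case of the
    -- rule.
    · obtain ⟨⟨A', B'⟩, hm, hX⟩ := Multiset.mem_map.mp hm
      obtain ⟨P, rfl⟩ := Multiset.exists_cons_of_mem hm
      subst hX
      obtain rfl : Γ' + Δ' + P.map (fun x => x.1 ◁ᶠ x.2) = Δ := by simpa using e
      exact hseq A' B' Γ' Δ' P A B rfl (h₁.of_eq (by simp)) (h₂.of_eq (by simp))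
  | @acutL Γ' Δ' A B C D h₁ h₂ ih₁ ih₂ =>
    intro Δ e
    have hm : X ∈ Γ' + Δ' := e ▸ Multiset.mem_cons_self _ _
    rcases Multiset.mem_add.mp hm with hm | hm
    · obtain ⟨Γ₁, rfl⟩ := Multiset.exists_cons_of_mem hm
      obtain rfl : Γ₁ + Δ' = Δ := by simpa using e
      exact (Entails.acutL (ih₁ _ rfl) h₂).of_eq (by abel)
    · obtain ⟨Δ₁, rfl⟩ := Multiset.exists_cons_of_mem hm
      obtain rfl : Γ' + Δ₁ = Δ := by simpa using e
      exact (Entails.acutL (Δ := Γ + Δ₁) h₁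
        ((ih₂ _ (Multiset.cons_swap _ _ _)).of_eq (by simp))).of_eq (by abel)
  | @acutR Γ' Δ' A B C D h₁ h₂ ih₁ ih₂ =>
    intro Δ e
    have hm : X ∈ Γ' + Δ' := e ▸ Multiset.mem_cons_self _ _
    rcases Multiset.mem_add.mp hm with hm | hm
    · obtain ⟨Γ₁, rfl⟩ := Multiset.exists_cons_of_mem hm
      obtain rfl : Γ₁ + Δ' = Δ := by simpa using e
      exact (Entails.acutR (ih₁ _ rfl) h₂).of_eq (by abel)
    · obtain ⟨Δ₁, rfl⟩ := Multiset.exists_cons_of_mem hm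
      obtain rfl : Γ' + Δ₁ = Δ := by simpa using e
      exact (Entails.acutR (Δ := Γ + Δ₁) h₁
        ((ih₂ _ (Multiset.cons_swap _ _ _)).of_eq (by simp))).of_eq (by abel)

/-- The cut rule with cut formula `X` is admissible. -/
def CutAdmissible (X : Formula α) : Prop :=
  ∀ Γ Δ C, Entails Γ X → Entails (X ::ₘ Δ) C → Entails (Γ + Δ) C

/-- Cut elimination, given the cuts on the immediate subformulas of the cut formula. -/
theorem CutAdmissible.of_subformulas {X : Formula α}
    (htens : ∀ A B, X = A ⊗ᶠ B → CutAdmissible A ∧ CutAdmissible B)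
    (himp : ∀ A B, X = A ⊸ᶠ B → CutAdmissible A ∧ CutAdmissible B)
    (hseq : ∀ A B, X = A ◁ᶠ B → CutAdmissible A ∧ CutAdmissible B) : CutAdmissible X := by
  intro Γ Δ E h
  -- Left rules and associative cuts keep the succedent of their last premise, so the cut moves into
  -- that premise. After a right rule, `Entails.replace` carries the cut up the other derivation
  -- until its formula is principal there too.
  induction h generalizing Δ E with
  | ax a => exact fun h => h.of_eq (by simp)
  | @impR Γ A B h _ =>
    intro h'
    obtain ⟨hA, hB⟩ := himp _ _ rfl
    refine Entails.replace (by simp) ?_ (by simp) (by simp) (by simp) h' Δ rfl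
    rintro _ _ Γ' Δ' C ⟨⟩ h₁ h₂
    exact (hB _ _ _ (hA _ _ _ h₁ h) h₂).of_eq (by abel)
  | @impL Γ Δ' A B C h₁ _ _ ih₂ =>
    intro h'
    refine (Entails.impL h₁ ((ih₂ htens himp hseq _ _ h').of_eq
      (Multiset.cons_add ..))).of_eq ?_
    simp only [← Multiset.singleton_add]; abel
  | unitR =>
    intro h'
    exact Entails.replace (by simp) (by simp) (by simp) (by simp) (by simp) h' Δ rfl
  | unitL _ ih =>
    intro h'
    exact (Entails.unitL (ih htens himp hseq _ _ h')).of_eq (by simp)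
  | @tensL Γ A B _ _ ih =>
    intro h'
    exact (Entails.tensL (A := A) (B := B) (Γ := Γ + Δ)
      ((ih htens himp hseq _ _ h').of_eq (by simp))).of_eq (by simp)
  | tensR h₁ h₂ _ _ =>
    intro h'
    obtain ⟨hA, hB⟩ := htens _ _ rfl
    refine Entails.replace (by simp) (by simp) (by simp) ?_ (by simp) h' Δ rfl
    rintro _ _ Δ' C ⟨⟩ h
    refine (hB _ _ _ h₂ ((hA _ _ _ h₁ h).of_eq (Multiset.add_cons ..))).of_eq (by abel)
  | @seq Γ Δ' P A B h₁ h₂ _ _ =>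
    intro h'
    obtain ⟨hA, hB⟩ := hseq _ _ rfl
    refine Entails.replace (by simp) (by simp) (by simp) (by simp) ?_ h' Δ rfl
    rintro _ _ Γ₁ Δ₁ P₁ C D ⟨⟩ h₃ h₄
    -- Two sequential rules merge into one: the pair being cut is replaced by the pairs `P` that
    -- produced it.
    refine (Entails.seq (Γ := Γ + Γ₁) (Δ := Δ' + Δ₁) (P + P₁)
      ((hA _ _ _ h₁ h₃).of_eq ?_) ((hB _ _ _ h₂ h₄).of_eq ?_)).of_eq ?_
    all_goals rw [Multiset.map_add]; abel
  | acutL h₁ _ _ ih₂ =>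
    intro h'
    exact (Entails.acutL h₁ ((ih₂ htens himp hseq _ _ h').of_eq
      (Multiset.cons_add ..))).of_eq (by abel)
  | acutR h₁ _ _ ih₂ =>
    intro h'
    exact (Entails.acutR h₁ ((ih₂ htens himp hseq _ _ h').of_eq
      (Multiset.cons_add ..))).of_eq (by abel)

theorem cutAdmissible (X : Formula α) : CutAdmissible X := by
  induction X with
  | atom a => exact .of_subformulas (by simp) (by simp) (by simp)
  | unit => exact .of_subformulas (by simp) (by simp) (by simp)
  | tens A B hA hB =>
    exact .of_subformulas (by rintro _ _ ⟨⟩; exact ⟨hA, hB⟩) (by simp) (by simp)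
  | imp A B hA hB =>
    exact .of_subformulas (by simp) (by rintro _ _ ⟨⟩; exact ⟨hA, hB⟩) (by simp)
  | seq A B hA hB =>
    exact .of_subformulas (by simp) (by simp) (by rintro _ _ ⟨⟩; exact ⟨hA, hB⟩)

theorem Entails.cut {X C : Formula α} {Γ Δ : Multiset (Formula α)} (h : Entails Γ X)
    (h' : Entails (X ::ₘ Δ) C) : Entails (Γ + Δ) C :=
  cutAdmissible X Γ Δ C h h'

/-! ### The rules of `IBV` in the sequent calculus -/

namespace Entails

/-- The rules of `IBV` need the sequential rule only for `n = 0` (units and refinement), `n = 1`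
(one side moves under `◁`) and `n = 2` (both sides do). -/
theorem seq_empty {Γ Δ : Multiset (Formula α)} {A B : Formula α} (h₁ : Entails Γ A)
    (h₂ : Entails Δ B) : Entails (Γ + Δ) (A ◁ᶠ B) :=
  (Entails.seq (Γ := Γ) (Δ := Δ) 0 (h₁.of_eq (by simp)) (h₂.of_eq (by simp))).of_eq (by simp)

theorem seq_singleton {Γ Δ : Multiset (Formula α)} {A B C D : Formula α}
    (h₁ : Entails (A ::ₘ Γ) C) (h₂ : Entails (B ::ₘ Δ) D) :
    Entails ((A ◁ᶠ B) ::ₘ (Γ + Δ)) (C ◁ᶠ D) := by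
  refine (Entails.seq (Γ := Γ) (Δ := Δ) {(A, B)} (h₁.of_eq ?_) (h₂.of_eq ?_)).of_eq ?_
  all_goals simp only [← Multiset.singleton_add, Multiset.map_singleton]; abel

theorem seq_pair {A A' B B' C D : Formula α}
    (h₁ : Entails (A ::ₘ {A'}) C) (h₂ : Entails (B ::ₘ {B'}) D) :
    Entails ((A ◁ᶠ B) ::ₘ {A' ◁ᶠ B'}) (C ◁ᶠ D) := by
  refine (Entails.seq (Γ := 0) (Δ := 0) ((A, B) ::ₘ {(A', B')}) (h₁.of_eq ?_)
    (h₂.of_eq ?_)).of_eq ?_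
  all_goals simp

theorem id (A : Formula α) : Entails {A} A := by
  induction A with
  | atom a => exact .ax a
  | unit => exact .unitL .unitR
  | tens A B hA hB => exact .tensL (hA.tensR hB)
  | imp A B hA hB =>
    exact .impR ((Entails.impL (Δ := 0) hA hB).of_eq (Multiset.cons_swap _ _ 0))
  | seq A B hA hB => exact seq_singleton (Γ := 0) (Δ := 0) hA hB

theorem cut_singleton {A B C : Formula α} (h₁ : Entails {A} B) (h₂ : Entails {B} C) :
    Entails {A} C := by
  simpa using h₁.cut (Δ := 0) h₂

theorem tens_left {A B C : Formula α} (h : Entails (A ::ₘ {B}) C) : Entails {A ⊗ᶠ B} C :=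
  .tensL (Γ := 0) h

theorem tens_mono {A B C D : Formula α} (h₁ : Entails {A} B) (h₂ : Entails {C} D) :
    Entails {A ⊗ᶠ C} (B ⊗ᶠ D) :=
  tens_left (h₁.tensR h₂)

theorem seq_mono {A B C D : Formula α} (h₁ : Entails {A} B) (h₂ : Entails {C} D) :
    Entails {A ◁ᶠ C} (B ◁ᶠ D) :=
  seq_singleton (Γ := 0) (Δ := 0) h₁ h₂

theorem imp_mono {A B C D : Formula α} (h₁ : Entails {B} A) (h₂ : Entails {C} D) :
    Entails {A ⊸ᶠ C} (B ⊸ᶠ D) :=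
  .impR ((Entails.impL (Δ := 0) h₁ h₂).of_eq (Multiset.cons_swap _ _ 0))

theorem modusPonens (A B : Formula α) : Entails (A ::ₘ {A ⊸ᶠ B}) B :=
  (Entails.impL (Δ := 0) (id A) (id B)).of_eq (Multiset.cons_swap _ _ 0)

theorem tens_pair (A B : Formula α) : Entails (A ::ₘ {B}) (A ⊗ᶠ B) := (id A).tensR (id B)

theorem refine_seq (A B : Formula α) : Entails {A ⊗ᶠ B} (A ◁ᶠ B) :=
  tens_left ((id A).seq_empty (id B))

theorem switchL (A B C : Formula α) : Entails {A ⊗ᶠ (B ⊸ᶠ C)} ((A ⊸ᶠ B) ⊸ᶠ C) := by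
  have h : Entails (A ::ₘ (B ⊸ᶠ C) ::ₘ {A ⊸ᶠ B}) C :=
    (Entails.impL (Δ := 0) (modusPonens A B) (id C)).of_eq
      (by simp only [← Multiset.singleton_add]; abel)
  exact .impR ((tensL h).of_eq (Multiset.cons_swap _ _ 0))

theorem switchR (A B C : Formula α) : Entails {(A ⊸ᶠ B) ⊗ᶠ C} (A ⊸ᶠ (B ⊗ᶠ C)) := by
  have h : Entails ((A ⊸ᶠ B) ::ₘ C ::ₘ {A}) (B ⊗ᶠ C) :=
    ((modusPonens A B).tensR (id C)).of_eq (by simp only [← Multiset.singleton_add]; abel)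
  exact .impR ((tensL h).of_eq (Multiset.cons_swap _ _ 0))

theorem imp_seqL (A B C : Formula α) : Entails {(A ⊸ᶠ B) ◁ᶠ C} (A ⊸ᶠ (B ◁ᶠ C)) := by
  refine .impR ((seq_singleton (Γ := {A}) (Δ := 0)
    ((modusPonens A B).of_eq (Multiset.cons_swap _ _ 0)) (id C)).of_eq ?_)
  simp only [← Multiset.singleton_add]; abel

theorem imp_seqR (A B C : Formula α) : Entails {B ◁ᶠ (A ⊸ᶠ C)} (A ⊸ᶠ (B ◁ᶠ C)) := by
  refine .impR ((seq_singleton (Γ := 0) (Δ := {A}) (id B)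
    ((modusPonens A C).of_eq (Multiset.cons_swap _ _ 0))).of_eq ?_)
  simp only [← Multiset.singleton_add]; abel

theorem tens_seqL (A B C : Formula α) : Entails {A ⊗ᶠ (B ◁ᶠ C)} ((A ⊗ᶠ B) ◁ᶠ C) := by
  refine tens_left ((seq_singleton (Γ := {A}) (Δ := 0)
    ((tens_pair A B).of_eq (Multiset.cons_swap _ _ 0)) (id C)).of_eq ?_)
  simp only [← Multiset.singleton_add]; abel

theorem tens_seqR (A B C : Formula α) : Entails {A ⊗ᶠ (B ◁ᶠ C)} (B ◁ᶠ (A ⊗ᶠ C)) := by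
  refine tens_left ((seq_singleton (Γ := 0) (Δ := {A}) (id B)
    ((tens_pair A C).of_eq (Multiset.cons_swap _ _ 0))).of_eq ?_)
  simp only [← Multiset.singleton_add]; abel

theorem imp_seq_imp (A B C D : Formula α) :
    Entails {(A ⊸ᶠ B) ◁ᶠ (C ⊸ᶠ D)} ((A ◁ᶠ C) ⊸ᶠ (B ◁ᶠ D)) :=
  .impR (seq_pair (modusPonens A B) (modusPonens C D))

theorem tens_seq_tens (A B C D : Formula α) :
    Entails {(A ◁ᶠ C) ⊗ᶠ (B ◁ᶠ D)} ((A ⊗ᶠ B) ◁ᶠ (C ⊗ᶠ D)) :=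
  tens_left (seq_pair (tens_pair A B) (tens_pair C D))

theorem tens_comm (A B : Formula α) : Entails {A ⊗ᶠ B} (B ⊗ᶠ A) :=
  tens_left ((tens_pair B A).of_eq (Multiset.cons_swap _ _ 0))

theorem tens_assoc (A B C : Formula α) : Entails {(A ⊗ᶠ B) ⊗ᶠ C} (A ⊗ᶠ (B ⊗ᶠ C)) :=
  tens_left (tensL ((id A).tensR (tens_pair B C)))

theorem tens_assoc_symm (A B C : Formula α) : Entails {A ⊗ᶠ (B ⊗ᶠ C)} ((A ⊗ᶠ B) ⊗ᶠ C) := by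
  have h : Entails (B ::ₘ C ::ₘ {A}) ((A ⊗ᶠ B) ⊗ᶠ C) :=
    ((tens_pair A B).tensR (id C)).of_eq (by simp only [← Multiset.singleton_add]; abel)
  exact tens_left ((tensL h).of_eq (Multiset.cons_swap _ _ 0))

/-- Only this lemma and its converse use the associative cuts in translating the rules. -/
theorem seq_assoc (A B C : Formula α) : Entails {(A ◁ᶠ B) ◁ᶠ C} (A ◁ᶠ (B ◁ᶠ C)) :=
  acutL (Δ := 0) (id _) (id _)

theorem seq_assoc_symm (A B C : Formula α) : Entails {A ◁ᶠ (B ◁ᶠ C)} ((A ◁ᶠ B) ◁ᶠ C) :=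
  acutR (Δ := 0) (id _) (id _)

theorem curry (A B C : Formula α) : Entails {(A ⊗ᶠ B) ⊸ᶠ C} (A ⊸ᶠ (B ⊸ᶠ C)) :=
  .impR (.impR ((Entails.impL (Δ := 0) (tens_pair A B) (id C)).of_eq
    (by simp only [← Multiset.singleton_add]; abel)))

theorem uncurry (A B C : Formula α) : Entails {A ⊸ᶠ (B ⊸ᶠ C)} ((A ⊗ᶠ B) ⊸ᶠ C) :=
  .impR (.tensL ((Entails.impL (Δ := {B}) (id A)
    ((modusPonens B C).of_eq (Multiset.cons_swap _ _ 0))).of_eq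
      (by simp only [← Multiset.singleton_add]; abel)))

theorem unit_imp (A : Formula α) : Entails {.unit ⊸ᶠ A} A :=
  impL (Γ := 0) (Δ := 0) unitR (id A)

end Entails

/-- The entailment between premise and conclusion expressed by a derivation: forwards for positive
derivations and backwards for negative ones. -/
def PolarEntails : Polarity → Formula α → Formula α → Prop
  | .pos, A, B => Entails {A} B
  | .neg, A, B => Entails {B} A

theorem PolarEntails.of_rules {p : Polarity} {A B : Formula α} (h : Rules p A B) :
    PolarEntails p A B := by
  cases h with
  | ai_down a => exact .unitL (.impR (.id _))
  | u_seq A => exact Entails.unitR.seq_empty (.id A) |>.of_eq (zero_add _)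
  | u_coseq A => exact (Entails.id A).seq_empty .unitR
  | ref_pos A B => exact .refine_seq A B
  | ref_neg A B => exact .refine_seq A B
  | sL_pos A B C => exact .switchL A B C
  | sR_pos A B C => exact .switchR A B C
  | sL_neg A B C => exact .switchL A B C
  | sR_neg A B C => exact .switchR A B C
  | sqL_pos A B C => exact .imp_seqL A B C
  | sqR_pos A B C => exact .imp_seqR A B C
  | sqL_neg A B C => exact .tens_seqL A B C
  | sqR_neg A B C => exact .tens_seqR A B C
  | q_pos A B C D => exact .imp_seq_imp A B C D
  | q_neg A B C D => exact .tens_seq_tens A B C D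
  | com p A B => cases p <;> exact .tens_comm _ _
  | asso_tens p A B C => cases p; exacts [.tens_assoc A B C, .tens_assoc_symm A B C]
  | asso_seqL p A B C => cases p; exacts [.seq_assoc A B C, .seq_assoc_symm A B C]
  | asso_seqR p A B C => cases p; exacts [.seq_assoc_symm A B C, .seq_assoc A B C]
  | u_tens p A =>
    cases p
    exacts [(Entails.unitR.tensR (.id A)).of_eq (zero_add _), .tens_left (.unitL (.id A))]
  | u_imp p A => cases p; exacts [.impR (.unitL (.id A)), .unit_imp A]
  | cur p A B C => cases p; exacts [.curry A B C, .uncurry A B C]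
  | ruc p A B C => cases p; exacts [.uncurry A B C, .curry A B C]

theorem PolarEntails.of_derivation {p : Polarity} {A B : Formula α} (h : Derivation Rules p A B) :
    PolarEntails p A B := by
  induction h with
  | refl p A => cases p <;> exact .id A
  | @tens p _ _ _ _ _ _ ih₁ ih₂ => cases p <;> exact Entails.tens_mono ih₁ ih₂
  | @seq p _ _ _ _ _ _ ih₁ ih₂ => cases p <;> exact Entails.seq_mono ih₁ ih₂
  | @imp p _ _ _ _ _ _ ih₁ ih₂ => cases p <;> exact Entails.imp_mono ih₁ ih₂
  | @comp p _ _ _ _ _ hR _ ih₁ ih₂ =>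
    have h := PolarEntails.of_rules hR
    cases p
    exacts [ih₁.cut_singleton (h.cut_singleton ih₂), ih₂.cut_singleton (h.cut_singleton ih₁)]

theorem DeepProvable.entails {A : Formula α} (h : DeepProvable Rules A) : Entails 0 A :=
  Entails.unitR.cut (Δ := 0) (PolarEntails.of_derivation h)

/-! ### Calculus of derivations -/

namespace Derivation

/-- `comp` demands a rule instance in the middle, so plain composition needs proof: two derivations
built with the same connective merge componentwise, and otherwise the composition is pushed up to
the next rule. -/
theorem trans {R : DeepRules α} {p : Polarity} {A B C : Formula α} (h₁ : Derivation R p A B)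
    (h₂ : Derivation R p B C) : Derivation R p A C := by
  induction h₁ generalizing C with
  | refl => exact h₂
  | comp h r _ _ ih => exact .comp h r (ih h₂)
  | @tens p A B A' B' f g ihf ihg =>
    generalize e : B ⊗ᶠ B' = X at h₂
    induction h₂ with
    | refl => exact e ▸ .tens f g
    | tens f' g' => cases e; exact .tens (ihf f') (ihg g')
    | seq | imp => cases e
    | comp _ r h ih => exact .comp (ih f g ihf ihg e) r h
  | @seq p A B A' B' f g ihf ihg =>
    generalize e : B ◁ᶠ B' = X at h₂
    induction h₂ with
    | refl => exact e ▸ .seq f g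
    | seq f' g' => cases e; exact .seq (ihf f') (ihg g')
    | tens | imp => cases e
    | comp _ r h ih => exact .comp (ih f g ihf ihg e) r h
  | @imp p A B A' B' f g ihf ihg =>
    generalize e : B ⊸ᶠ B' = X at h₂
    induction h₂ with
    | refl => exact e ▸ .imp f g
    | imp f' g' => cases e; exact .imp (ihf f') (ihg g')
    | tens | seq => cases e
    | comp _ r h ih => exact .comp (ih f g ihf ihg e) r h

theorem rule {R : DeepRules α} {p : Polarity} {A B : Formula α} (h : R p A B) :
    Derivation R p A B :=
  .comp (.refl p A) h (.refl p B)

theorem tens_assoc_symm (p : Polarity) (A B C : Formula α) :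
    Derivation Rules p (A ⊗ᶠ (B ⊗ᶠ C)) ((A ⊗ᶠ B) ⊗ᶠ C) :=
  .comp (.refl _ _) (.com p _ _) <| .comp (.tens (.rule (.com p _ _)) (.refl _ _))
    (.asso_tens p _ _ _) <| .comp (.refl _ _) (.com p _ _) <|
    .tens (.rule (.com p _ _)) (.refl _ _)

theorem imp_of_provable {p : Polarity} {A : Formula α} (B : Formula α)
    (h : Derivation Rules p.flip .unit A) : Derivation Rules p B (A ⊸ᶠ B) :=
  .comp (.refl _ _) (.u_imp p B) (.imp h (.refl _ _))

theorem tens_of_provable {p : Polarity} {A : Formula α} (B : Formula α)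
    (h : Derivation Rules p .unit A) : Derivation Rules p B (A ⊗ᶠ B) :=
  .comp (.refl _ _) (.u_tens p B) (.tens h (.refl _ _))

end Derivation

/-! ### Contexts

A context is either empty (`none`) or a formula in negative position. -/

/-- The tensor product of contexts, with the empty context as strict unit. -/
def ctxTens : Option (Formula α) → Option (Formula α) → Option (Formula α)
  | none, w => w
  | some A, none => some A
  | some A, some B => some (A ⊗ᶠ B)

/-- The sequential product of contexts, with the empty context as strict unit. -/
def ctxSeq : Option (Formula α) → Option (Formula α) → Option (Formula α)
  | none, w => w
  | some A, none => some A
  | some A, some B => some (A ◁ᶠ B)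

/-- The implication from a context to a formula. -/
def ctxImp : Option (Formula α) → Formula α → Formula α
  | none, S => S
  | some A, S => A ⊸ᶠ S

/-- The order on contexts: `CtxLe w v` if there is a negative derivation from `v` to `w`, where the
empty context is treated as the unit when `w` is a formula. -/
def CtxLe : Option (Formula α) → Option (Formula α) → Prop
  | none, none => True
  | none, some _ => False
  | some A, none => Derivation Rules .neg .unit A
  | some A, some B => Derivation Rules .neg B A

namespace CtxLe

theorem refl (w : Option (Formula α)) : CtxLe w w := by
  rcases w with _ | A
  exacts [trivial, Derivation.refl _ _]

theorem trans {u v w : Option (Formula α)} (h₁ : CtxLe u v) (h₂ : CtxLe v w) : CtxLe u w := by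
  rcases u with _ | A <;> rcases v with _ | B <;> rcases w with _ | C
  all_goals first
    | exact h₁.elim | exact h₂.elim | trivial | exact h₁ | exact Derivation.trans h₂ h₁

theorem tens_right {u v : Option (Formula α)} (h : CtxLe u v) (w : Option (Formula α)) :
    CtxLe (ctxTens u w) (ctxTens v w) := by
  rcases u with _ | A <;> rcases v with _ | B <;> rcases w with _ | C
  all_goals first
    | exact h | exact h.elim | exact CtxLe.refl _ | exact Derivation.tens_of_provable _ h
    | exact Derivation.tens h (.refl _ _)

theorem tens_comm (u v : Option (Formula α)) : CtxLe (ctxTens u v) (ctxTens v u) := by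
  rcases u with _ | A <;> rcases v with _ | B
  exacts [trivial, CtxLe.refl _, CtxLe.refl _, Derivation.rule (.com _ _ _)]

theorem tens_mono {u u' v v' : Option (Formula α)} (h : CtxLe u u') (h' : CtxLe v v') :
    CtxLe (ctxTens u v) (ctxTens u' v') :=
  (h.tens_right v).trans <| (tens_comm _ _).trans <| (h'.tens_right u').trans (tens_comm _ _)

theorem tens_assoc (u v w : Option (Formula α)) :
    CtxLe (ctxTens (ctxTens u v) w) (ctxTens u (ctxTens v w)) := by
  rcases u with _ | A <;> rcases v with _ | B <;> rcases w with _ | C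
  all_goals first | exact CtxLe.refl _ | exact Derivation.tens_assoc_symm _ _ _ _

theorem seq_assoc (u v w : Option (Formula α)) :
    CtxLe (ctxSeq (ctxSeq u v) w) (ctxSeq u (ctxSeq v w)) := by
  rcases u with _ | A <;> rcases v with _ | B <;> rcases w with _ | C
  all_goals first | exact CtxLe.refl _ | exact Derivation.rule (.asso_seqR _ _ _ _)

theorem seq_assoc_symm (u v w : Option (Formula α)) :
    CtxLe (ctxSeq u (ctxSeq v w)) (ctxSeq (ctxSeq u v) w) := by
  rcases u with _ | A <;> rcases v with _ | B <;> rcases w with _ | C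
  all_goals first | exact CtxLe.refl _ | exact Derivation.rule (.asso_seqL _ _ _ _)

/-- The restriction to formulas matters: with `none` in place of `some B` one would need a unit rule
for `◁` at negative positions. -/
theorem seq_right {A B : Formula α} (h : CtxLe (some A) (some B)) (w : Option (Formula α)) :
    CtxLe (ctxSeq (some A) w) (ctxSeq (some B) w) := by
  rcases w with _ | C
  exacts [h, Derivation.seq h (.refl _ _)]

theorem seq_left {A B : Formula α} (h : CtxLe (some A) (some B)) (w : Option (Formula α)) :
    CtxLe (ctxSeq w (some A)) (ctxSeq w (some B)) := by
  rcases w with _ | C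
  exacts [h, .seq (.refl _ _) h]

/-- With four formulas this is `q_neg`. Emptying some of the contexts turns it into `sqL_neg`,
`sqR_neg`, `ref_neg` or `com`, up to commutativity. -/
theorem exchange (a b c d : Option (Formula α)) :
    CtxLe (ctxTens (ctxSeq a b) (ctxSeq c d)) (ctxSeq (ctxTens a c) (ctxTens b d)) := by
  rcases a with _ | A <;> rcases b with _ | B <;> rcases c with _ | C <;> rcases d with _ | D
  all_goals first
    | exact trivial | exact CtxLe.refl _
    | exact Derivation.rule (.ref_neg _ _) | exact Derivation.rule (.com _ _ _)
    | exact Derivation.rule (.q_neg _ _ _ _) | exact Derivation.rule (.sqL_neg _ _ _)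
    | exact Derivation.rule (.sqR_neg _ _ _)
    | exact Derivation.comp (.refl _ _) (.ref_neg _ _) (.rule (Rules.com _ _ _))
    | exact Derivation.comp (.seq (.rule (Rules.com _ _ _)) (.refl _ _)) (.sqL_neg _ _ _)
        (.rule (Rules.com _ _ _))
    | exact Derivation.comp (.seq (.refl _ _) (.rule (Rules.com _ _ _))) (.sqR_neg _ _ _)
        (.rule (Rules.com _ _ _))

theorem imp {w v : Option (Formula α)} (h : CtxLe w v) (S : Formula α) :
    Derivation Rules .pos (ctxImp v S) (ctxImp w S) := by
  rcases w with _ | A <;> rcases v with _ | B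
  exacts [Derivation.refl _ _, h.elim, .imp_of_provable S h, .imp h (.refl _ _)]

end CtxLe

theorem ctxSeq_none (w : Option (Formula α)) : ctxSeq w none = w := by cases w <;> rfl

theorem Derivation.ctxImp {S T : Formula α} (h : Derivation Rules .pos S T)
    (w : Option (Formula α)) : Derivation Rules .pos (IBV.ctxImp w S) (IBV.ctxImp w T) := by
  cases w
  exacts [h, .imp (.refl _ _) h]

theorem ctxImp_curry (u v : Option (Formula α)) (S : Formula α) :
    Derivation Rules .pos (ctxImp (ctxTens u v) S) (ctxImp u (ctxImp v S)) := by
  rcases u with _ | A <;> rcases v with _ | B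
  all_goals first | exact .refl _ _ | exact .rule (.cur _ _ _ _)

theorem ctxImp_uncurry (u v : Option (Formula α)) (S : Formula α) :
    Derivation Rules .pos (ctxImp u (ctxImp v S)) (ctxImp (ctxTens u v) S) := by
  rcases u with _ | A <;> rcases v with _ | B
  all_goals first | exact .refl _ _ | exact .rule (.ruc _ _ _ _)

theorem ctxImp_swap (u v : Option (Formula α)) (S : Formula α) :
    Derivation Rules .pos (ctxImp u (ctxImp v S)) (ctxImp v (ctxImp u S)) :=
  (ctxImp_uncurry u v S).trans <| ((CtxLe.tens_comm v u).imp S).trans (ctxImp_curry v u S)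

theorem ctxImp_seq (u v : Option (Formula α)) (S T : Formula α) :
    Derivation Rules .pos (ctxImp u S ◁ᶠ ctxImp v T) (ctxImp (ctxSeq u v) (S ◁ᶠ T)) := by
  rcases u with _ | A <;> rcases v with _ | B
  exacts [.refl _ _, .rule (.sqR_pos _ _ _), .rule (.sqL_pos _ _ _), .rule (.q_pos _ _ _ _)]

theorem DeepProvable.seq {A B : Formula α} (hA : DeepProvable Rules A)
    (hB : DeepProvable Rules B) : DeepProvable Rules (A ◁ᶠ B) :=
  .comp (.refl _ _) (.u_seq _) (.seq hA hB)

/-! ### The model -/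

/-- A point of the model: a set `pos` of contexts and a set `neg` of formulas such that all
implications from `pos` to `neg` are provable. -/
@[ext]
structure Chu (α : Type*) where
  pos : Set (Option (Formula α))
  neg : Set (Formula α)
  pos_closed : ∀ {w v}, CtxLe w v → v ∈ pos → w ∈ pos
  neg_closed : ∀ {S T}, Derivation Rules .pos S T → S ∈ neg → T ∈ neg
  pairing : ∀ {w S}, w ∈ pos → S ∈ neg → DeepProvable Rules (ctxImp w S)

namespace Chu

instance : PartialOrder (Chu α) where
  le X Y := X.pos ⊆ Y.pos ∧ Y.neg ⊆ X.neg
  le_refl X := ⟨subset_rfl, subset_rfl⟩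
  le_trans X Y Z h h' := ⟨h.1.trans h'.1, h'.2.trans h.2⟩
  le_antisymm X Y h h' := Chu.ext (h.1.antisymm h'.1) (h'.2.antisymm h.2)

instance : One (Chu α) where
  one :=
    { pos := {w | CtxLe w none}
      neg := {S | DeepProvable Rules S}
      pos_closed := fun h h' => h.trans h'
      neg_closed := fun h h' => Derivation.trans h' h
      pairing := fun hw hS => Derivation.trans hS (hw.imp _) }

theorem none_mem_one : none ∈ (1 : Chu α).pos := CtxLe.refl (none : Option (Formula α))

/-- The Chu tensor: a refutation of the product must turn each context of either factor into a
refutation of the other. -/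
instance : Mul (Chu α) where
  mul X Y :=
    { pos := {w | ∃ a ∈ X.pos, ∃ b ∈ Y.pos, CtxLe w (ctxTens a b)}
      neg := {S | (∀ a ∈ X.pos, ctxImp a S ∈ Y.neg) ∧ ∀ b ∈ Y.pos, ctxImp b S ∈ X.neg}
      pos_closed := fun h ⟨a, ha, b, hb, h'⟩ => ⟨a, ha, b, hb, h.trans h'⟩
      neg_closed := fun h h' => ⟨fun a ha => Y.neg_closed (h.ctxImp a) (h'.1 a ha),
        fun b hb => X.neg_closed (h.ctxImp b) (h'.2 b hb)⟩
      pairing := fun ⟨a, ha, b, hb, h⟩ hS => Derivation.trans (X.pairing ha (hS.2 b hb))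
        ((ctxImp_uncurry a b _).trans (h.imp _)) }

/-- The linear implication of the model. -/
def imp (X Y : Chu α) : Chu α where
  pos := {w | (∀ a ∈ X.pos, ctxTens w a ∈ Y.pos) ∧ ∀ S ∈ Y.neg, ctxImp w S ∈ X.neg}
  neg := {S | ∃ a ∈ X.pos, ∃ T ∈ Y.neg, Derivation Rules .pos (ctxImp a T) S}
  pos_closed := fun h h' => ⟨fun a ha => Y.pos_closed (h.tens_right a) (h'.1 a ha),
    fun S hS => X.neg_closed (h.imp S) (h'.2 S hS)⟩
  neg_closed := fun h ⟨a, ha, T, hT, h'⟩ => ⟨a, ha, T, hT, h'.trans h⟩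
  pairing := fun {w _} hw ⟨a, ha, T, hT, h⟩ => Derivation.trans (Y.pairing (hw.1 a ha) hT)
    ((ctxImp_curry w a T).trans (h.ctxImp w))

/-- The sequential product of the model. -/
def seq (X Y : Chu α) : Chu α where
  pos := {w | ∃ a ∈ X.pos, ∃ b ∈ Y.pos, CtxLe w (ctxSeq a b)}
  neg := {S | ∃ T ∈ X.neg, ∃ U ∈ Y.neg, Derivation Rules .pos (T ◁ᶠ U) S}
  pos_closed := fun h ⟨a, ha, b, hb, h'⟩ => ⟨a, ha, b, hb, h.trans h'⟩
  neg_closed := fun h ⟨T, hT, U, hU, h'⟩ => ⟨T, hT, U, hU, h'.trans h⟩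
  pairing := fun {w _} ⟨a, ha, b, hb, h⟩ ⟨T, hT, U, hU, h'⟩ =>
    Derivation.trans ((X.pairing ha hT).seq (Y.pairing hb hU))
      ((ctxImp_seq a b T U).trans ((h.imp _).trans (h'.ctxImp w)))

protected theorem mul_comm_le (X Y : Chu α) : X * Y ≤ Y * X :=
  ⟨fun _ ⟨a, ha, b, hb, h⟩ => ⟨b, hb, a, ha, h.trans (.tens_comm _ _)⟩, fun _ h => ⟨h.2, h.1⟩⟩

protected theorem mul_assoc_le (X Y Z : Chu α) : X * Y * Z ≤ X * (Y * Z) := by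
  refine ⟨?_, ?_⟩
  · rintro w ⟨m, ⟨a, ha, b, hb, hm⟩, c, hc, hw⟩
    exact ⟨a, ha, _, ⟨b, hb, c, hc, .refl _⟩,
      hw.trans ((hm.tens_right c).trans (.tens_assoc _ _ _))⟩
  · rintro S ⟨h₁, h₂⟩
    refine ⟨?_, fun c hc => ⟨fun a ha => ?_, fun b hb => ?_⟩⟩
    · rintro w ⟨a, ha, b, hb, hw⟩
      exact Z.neg_closed ((ctxImp_uncurry a b S).trans (hw.imp S))
        (Z.neg_closed (ctxImp_swap b a S) ((h₁ a ha).1 b hb))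
    · exact Y.neg_closed (ctxImp_swap c a S) ((h₁ a ha).2 c hc)
    · exact X.neg_closed (ctxImp_curry b c S)
        (h₂ _ ⟨b, hb, c, hc, .refl _⟩)

protected theorem one_mul_eq (X : Chu α) : 1 * X = X := by
  refine le_antisymm (And.intro ?_ ?_) (And.intro ?_ ?_)
  · rintro w ⟨a, ha, b, hb, h⟩
    exact X.pos_closed (h.trans (CtxLe.tens_right ha b)) hb
  · exact fun S hS => ⟨fun a ha => X.neg_closed (CtxLe.imp ha S) hS, fun b hb => X.pairing hb hS⟩
  · exact fun w hw => ⟨none, none_mem_one, w, hw, CtxLe.refl _⟩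
  · exact fun S hS => hS.1 none none_mem_one

instance : CommMonoid (Chu α) where
  mul_comm X Y := (Chu.mul_comm_le X Y).antisymm (Chu.mul_comm_le Y X)
  mul_assoc X Y Z := by
    have comm (X Y : Chu α) : X * Y = Y * X :=
      (Chu.mul_comm_le X Y).antisymm (Chu.mul_comm_le Y X)
    refine (Chu.mul_assoc_le X Y Z).antisymm ?_
    rw [comm X (Y * Z), comm Y Z, comm (X * Y) Z, comm X Y]
    exact Chu.mul_assoc_le Z Y X
  one_mul := Chu.one_mul_eq
  mul_one X := ((Chu.mul_comm_le X 1).antisymm (Chu.mul_comm_le 1 X)).trans (Chu.one_mul_eq X)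

instance : IsOrderedMonoid (Chu α) where
  mul_le_mul_left X Y h Z := by
    refine ⟨?_, ?_⟩
    · rintro w ⟨a, ha, b, hb, hw⟩
      exact ⟨a, h.1 ha, b, hb, hw⟩
    · exact fun S hS => ⟨fun a ha => hS.1 a (h.1 ha), fun b hb => h.2 (hS.2 b hb)⟩

theorem le_imp_iff {X Y Z : Chu α} : X ≤ Y.imp Z ↔ X * Y ≤ Z := by
  refine ⟨fun h => ⟨?_, fun S hS => ⟨fun a ha => (h.1 ha).2 S hS, fun b hb => ?_⟩⟩,
    fun h => ⟨fun w hw => ⟨fun b hb => ?_, fun S hS => (h.2 hS).1 w hw⟩, ?_⟩⟩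
  · rintro w ⟨a, ha, b, hb, hw⟩
    exact Z.pos_closed hw ((h.1 ha).1 b hb)
  · exact h.2 ⟨b, hb, S, hS, .refl _ _⟩
  · exact h.1 ⟨w, hw, b, hb, .refl _⟩
  · rintro S ⟨b, hb, T, hT, hS⟩
    exact X.neg_closed hS ((h.2 hT).2 b hb)

theorem seq_mono {X Y Z W : Chu α} (h : X ≤ Y) (h' : Z ≤ W) : X.seq Z ≤ Y.seq W :=
  ⟨fun _ ⟨a, ha, b, hb, hw⟩ => ⟨a, h.1 ha, b, h'.1 hb, hw⟩,
    fun _ ⟨T, hT, U, hU, hS⟩ => ⟨T, h.2 hT, U, h'.2 hU, hS⟩⟩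

/-- This equality validates the associative cuts. On contexts it is delicate, since `ctxSeq` is not
known to be monotone when a formula is compared with the empty context. -/
theorem seq_assoc (X Y Z : Chu α) : (X.seq Y).seq Z = X.seq (Y.seq Z) := by
  refine le_antisymm (And.intro ?_ ?_) (And.intro ?_ ?_)
  · rintro w ⟨m, ⟨a, ha, b, hb, hm⟩, c, hc, hw⟩
    rcases m with _ | M
    · refine ⟨none, ?_, c, ⟨none, ?_, c, hc, .refl _⟩, hw⟩ <;>
        rcases a with _ | A <;> rcases b with _ | B <;> first | assumption | exact hm.elim
    -- If `ctxSeq a b` is empty, so are `a` and `b`, and `M` itself can stand in for `a` by closure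
    -- of `X.pos`.
    · rcases e : ctxSeq a b with _ | N
      · obtain rfl : a = none := by
          rcases a with _ | A <;> rcases b with _ | B <;> simp_all [ctxSeq]
        obtain rfl : b = none := e
        exact ⟨some M, X.pos_closed hm ha, c, ⟨none, hb, c, hc, .refl _⟩, hw⟩
      · refine ⟨a, ha, _, ⟨b, hb, c, hc, .refl _⟩, hw.trans ?_⟩
        rw [e] at hm
        exact (hm.seq_right c).trans (e ▸ .seq_assoc a b c)
  · rintro S ⟨T, hT, m, ⟨U, hU, V, hV, hm⟩, hS⟩
    exact ⟨_, ⟨T, hT, U, hU, .refl _ _⟩, V, hV,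
      .comp (.refl _ _) (.asso_seqL _ _ _ _) (.trans (.seq (.refl _ _) hm) hS)⟩
  · rintro w ⟨a, ha, m, ⟨b, hb, c, hc, hm⟩, hw⟩
    rcases m with _ | M
    · refine ⟨a, ⟨a, ha, none, ?_, by rw [ctxSeq_none]; exact .refl _⟩, none, ?_, hw⟩ <;>
        rcases b with _ | B <;> rcases c with _ | C <;> first | assumption | exact hm.elim
    · rcases e : ctxSeq b c with _ | N
      · obtain rfl : b = none := by
          rcases b with _ | B <;> rcases c with _ | C <;> simp_all [ctxSeq]
        obtain rfl : c = none := e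
        exact ⟨a, ⟨a, ha, none, hb, by rw [ctxSeq_none]; exact .refl _⟩, some M,
          Z.pos_closed hm hc, hw⟩
      · refine ⟨_, ⟨a, ha, b, hb, .refl _⟩, c, hc, hw.trans ?_⟩
        rw [e] at hm
        exact (hm.seq_left a).trans (e ▸ .seq_assoc_symm a b c)
  · rintro S ⟨m, ⟨T, hT, U, hU, hm⟩, V, hV, hS⟩
    exact ⟨T, hT, _, ⟨U, hU, V, hV, .refl _ _⟩,
      .comp (.refl _ _) (.asso_seqR _ _ _ _) (.trans (.seq hm (.refl _ _)) hS)⟩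

theorem seq_mul_seq_le (X Y Z W : Chu α) : X.seq Y * Z.seq W ≤ (X * Z).seq (Y * W) := by
  refine ⟨?_, ?_⟩
  · rintro w ⟨u, ⟨a, ha, b, hb, hu⟩, v, ⟨c, hc, d, hd, hv⟩, hw⟩
    exact ⟨_, ⟨a, ha, c, hc, .refl _⟩, _, ⟨b, hb, d, hd, .refl _⟩,
      hw.trans ((hu.tens_mono hv).trans (.exchange a b c d))⟩
  · rintro S ⟨T, hT, U, hU, hS⟩
    refine ⟨?_, ?_⟩
    · rintro w ⟨a, ha, b, hb, hw⟩
      exact ⟨_, hT.1 a ha, _, hU.1 b hb,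
        (ctxImp_seq a b T U).trans ((hw.imp _).trans (hS.ctxImp w))⟩
    · rintro w ⟨a, ha, b, hb, hw⟩
      exact ⟨_, hT.2 a ha, _, hU.2 b hb,
        (ctxImp_seq a b T U).trans ((hw.imp _).trans (hS.ctxImp w))⟩

/-- The empty context is a strict unit on one half, and `u_seq` serves the other. Only this lax unit
law is needed. -/
theorem le_one_seq (X : Chu α) : X ≤ seq 1 X := by
  refine ⟨fun w hw => ⟨none, none_mem_one, w, hw, .refl _⟩, ?_⟩
  rintro S ⟨T, hT, U, hU, hS⟩
  exact X.neg_closed (.comp (.refl _ _) (.u_seq U) (.trans (.seq hT (.refl _ _)) hS)) hU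

theorem le_seq_one (X : Chu α) : X ≤ seq X 1 := by
  refine ⟨fun w hw => ⟨w, hw, none, none_mem_one, by rw [ctxSeq_none]; exact .refl _⟩, ?_⟩
  rintro S ⟨T, hT, U, hU, hS⟩
  exact X.neg_closed (.comp (.refl _ _) (.u_coseq T) (.trans (.seq (.refl _ _) hU) hS)) hT

/-- An Eckmann–Hilton argument: insert units, then interchange. -/
theorem mul_le_seq (X Y : Chu α) : X * Y ≤ X.seq Y :=
  calc X * Y ≤ X.seq 1 * seq 1 Y := mul_le_mul' X.le_seq_one Y.le_one_seq
    _ ≤ (X * 1).seq (1 * Y) := seq_mul_seq_le X 1 1 Y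
    _ = X.seq Y := by rw [mul_one, one_mul]

theorem prod_seq_le {ι : Type*} (P : Multiset ι) (f g : ι → Chu α) :
    (P.map fun i => (f i).seq (g i)).prod ≤ (P.map f).prod.seq (P.map g).prod := by
  induction P using Multiset.induction with
  | empty => simpa using le_one_seq (1 : Chu α)
  | cons i P ih =>
    simp only [Multiset.map_cons, Multiset.prod_cons]
    exact (mul_le_mul_right ih _).trans (seq_mul_seq_le _ _ _ _)

/-- The interpretation of an atom. -/
def atom (a : α) : Chu α where
  pos := {w | CtxLe w (some (.atom a))}
  neg := {S | Derivation Rules .pos (.atom a) S}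
  pos_closed := fun h h' => h.trans h'
  neg_closed := fun h h' => h'.trans h
  pairing := fun {w _} hw hS => .comp (.refl _ _) (.ai_down a) ((hw.imp _).trans (hS.ctxImp w))

end Chu

/-- The interpretation of formulas in the model. -/
def Formula.interp : Formula α → Chu α
  | .atom a => Chu.atom a
  | .unit => 1
  | .tens A B => A.interp * B.interp
  | .imp A B => A.interp.imp B.interp
  | .seq A B => A.interp.seq B.interp

/-- Every formula belongs to both components of its own interpretation. -/
theorem Formula.mem_interp (A : Formula α) : some A ∈ A.interp.pos ∧ A ∈ A.interp.neg := by
  induction A with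
  | atom a => exact ⟨CtxLe.refl (some (.atom a)), Derivation.refl _ _⟩
  | unit => exact ⟨Derivation.refl _ _, Derivation.refl _ _⟩
  | tens A B hA hB =>
    refine ⟨⟨_, hA.1, _, hB.1, .refl _⟩, fun w hw => ?_, fun w hw => ?_⟩
    -- The pairing makes `w ⊸ A` provable, so it can be tensored onto `B` for free; the switch rule
    -- then moves `B` under the implication. The other tensor and implication cases run likewise.
    · have h := A.interp.pairing hw hA.2
      refine B.interp.neg_closed ((Derivation.tens_of_provable B h).trans ?_) hB.2
      rcases w with _ | C
      exacts [.refl _ _, .rule (.sR_pos _ _ _)]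
    · have h := B.interp.pairing hw hB.2
      refine A.interp.neg_closed ((Derivation.tens_of_provable A h).trans ?_) hA.2
      rcases w with _ | C
      exacts [.rule (.com _ _ _),
        .comp (.refl _ _) (.sR_pos _ _ _) (.imp (.refl _ _) (.rule (.com _ _ _)))]
  | imp A B hA hB =>
    refine ⟨⟨fun w hw => ?_, fun S hS => ?_⟩, ⟨_, hA.1, _, hB.2, .refl _ _⟩⟩
    · have h := A.interp.pairing hw hA.2
      refine B.interp.pos_closed (v := some B) ?_ hB.1
      rcases w with _ | C
      exacts [Derivation.imp_of_provable B h, (Derivation.imp_of_provable (p := .neg) B h).trans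
        (.comp (.refl _ _) (.sL_neg _ _ _) (.rule (.com _ _ _)))]
    · have h := B.interp.pairing hB.1 hS
      exact A.interp.neg_closed ((Derivation.tens_of_provable A h).trans
        (.comp (.refl _ _) (.com _ _ _) (.rule (.sL_pos _ _ _)))) hA.2
  | seq A B hA hB =>
    exact ⟨⟨_, hA.1, _, hB.1, .refl _⟩, ⟨_, hA.2, _, hB.2, .refl _ _⟩⟩

/-- The sequent calculus with associative cuts is sound for the model. -/
theorem Entails.prod_interp_le {Γ : Multiset (Formula α)} {A : Formula α} (h : Entails Γ A) :
    (Γ.map Formula.interp).prod ≤ A.interp := by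
  induction h with
  | ax a => simp
  | impR _ ih =>
    refine Chu.le_imp_iff.mpr ?_
    rwa [Multiset.map_cons, Multiset.prod_cons, mul_comm] at ih
  | @impL Γ Δ A B C _ _ ih₁ ih₂ =>
    simp only [Multiset.map_cons, Multiset.prod_cons, Multiset.map_add, Multiset.prod_add] at ih₂ ⊢
    refine le_trans ?_ ih₂
    rw [← mul_assoc]
    refine mul_le_mul_left ((mul_le_mul_right ih₁ _).trans ?_) _
    exact Chu.le_imp_iff.mp le_rfl
  | unitR => simp [Formula.interp]
  | unitL _ ih => simpa [Formula.interp] using ih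
  | tensL _ ih => simpa [Formula.interp, mul_assoc] using ih
  | tensR _ _ ih₁ ih₂ => simpa [Formula.interp] using mul_le_mul' ih₁ ih₂
  | @seq Γ Δ P A B _ _ ih₁ ih₂ =>
    simp only [Multiset.map_add, Multiset.prod_add, Multiset.map_map] at ih₁ ih₂ ⊢
    -- The side contexts `Γ` and `Δ` are treated as one more sequential pair, which interchange
    -- merges with the pairs in `P`.
    calc _ ≤ _ := mul_le_mul' (Chu.mul_le_seq _ _)
          (Chu.prod_seq_le P (fun x => x.1.interp) (fun x => x.2.interp))
      _ ≤ _ := Chu.seq_mul_seq_le _ _ _ _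
      _ ≤ _ := Chu.seq_mono ih₁ ih₂
  | acutL _ _ ih₁ ih₂ =>
    simp only [Multiset.map_cons, Multiset.prod_cons, Multiset.map_add, Multiset.prod_add,
      Formula.interp, Chu.seq_assoc] at ih₁ ih₂ ⊢
    exact (mul_le_mul_left ih₁ _).trans ih₂
  | acutR _ _ ih₁ ih₂ =>
    simp only [Multiset.map_cons, Multiset.prod_cons, Multiset.map_add, Multiset.prod_add,
      Formula.interp, Chu.seq_assoc] at ih₁ ih₂ ⊢
    exact (mul_le_mul_left ih₁ _).trans ih₂

theorem Entails.deepProvable {A : Formula α} (h : Entails 0 A) : DeepProvable Rules A :=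
  A.interp.pairing (w := none) (h.prod_interp_le.1 Chu.none_mem_one) A.mem_interp.2

end IBV

theorem mainTheorem6 {α : Type*} [Countable α] (A : IBV.Formula α) :
    IBV.DeepProvable IBV.Rules A ↔
      IBV.SequentProvable (IBV.INML ⊔ IBV.AcutL ⊔ IBV.AcutR) A :=
  ⟨fun h => h.entails.sequentDerivable, fun h => (IBV.Entails.of_sequentDerivable h).deepProvable⟩
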